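/- Let $X$ be a complex Banach space, let $1\le p<\infty$, and let $E=\ell_p(X)$ be the Banach space of sequences $(x_n)_{n\in\mathbb N}$ in $X$ with $\|(x_n)\|=\bigl(\sum_n\|x_n\|^p\bigr)^{1/p}<\infty$. Let $\mathcal B(E)$ be the Banach algebra of bounded linear operators on $E$, and let $\mathcal A(E)\subseteq\mathcal B(E)$ be the closed two-sided ideal of approximable operators, i.e. the operator-norm closure of the finite rank operators. The dual $\mathcal A(E)^*$ is a $\mathcal B(E)$-bimodule with the actions $$\langle A,S\cdot\varphi\rangle=\langle AS,\varphi\rangle,\qquad \langle A,\varphi\cdot S\rangle=\langle SA,\varphi\rangle\qquad(A\in\mathcal A(E),\ S\in\mathcal B(E),\ \varphi\in\mathcal A(E)^*).$$ Then every bounded derivation $D\colon\mathcal B(E)\to\mathcal A(E)^*$, that is, every bounded linear map with $D(ST)=S\cdot D(T)+D(S)\cdot T$ for all $S,T\in\mathcal B(E)$, is inner: there is $\varphi\in\mathcal A(E)^*$ with $D(S)=S\cdot\varphi-\varphi\cdot S$ for all $S\in\mathcal B(E)$. Equivalently, the first bounded Hochschild cohomology group (bounded derivations modulo inner derivations) vanishes: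 $$\mathcal H^1\bigl(\mathcal B(\ell_p(X)),\mathcal A(\ell_p(X))^*\bigr)=\{0\}.$$ -/

import Mathlib

open scoped ENNReal

noncomputable section

namespace BanachCohomology

variable (E : Type*) [NormedAddCommGroup E] [NormedSpace ℂ E]

/-- The finite rank operators on `E`, as a linear subspace of the bounded operators `ℬ(E)`. -/
def finiteRankOperators : Submodule ℂ (E →L[ℂ] E) where
  carrier := {T | FiniteDimensional ℂ (LinearMap.range (T : E →ₗ[ℂ] E))}
  zero_mem' := by
    have h : LinearMap.range ((0 : E →L[ℂ] E) : E →ₗ[ℂ] E) = ⊥ := by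
      rw [ContinuousLinearMap.toLinearMap_zero]
      exact LinearMap.range_zero
    simp only [Set.mem_ofPred_eq]
    rw [h]
    infer_instance
  add_mem' := by
    intro S T hS hT
    simp only [Set.mem_ofPred_eq] at hS hT ⊢
    rw [ContinuousLinearMap.toLinearMap_add]
    exact Submodule.finiteDimensional_of_le (LinearMap.range_add_le _ _)
  smul_mem' := by
    intro c T hT
    simp only [Set.mem_ofPred_eq] at hT ⊢
    refine Submodule.finiteDimensional_of_le
      (S₂ := LinearMap.range (T : E →ₗ[ℂ] E)) ?_
    rintro _ ⟨x, rfl⟩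
    exact ⟨c • x, by simp⟩

/-- The approximable operators `𝒜(E)`: the closure of the finite rank operators in the operator
norm.  It carries the operator norm. -/
def approximableOperators : Submodule ℂ (E →L[ℂ] E) :=
  (finiteRankOperators E).topologicalClosure

variable {E}

theorem comp_finiteRank (S : E →L[ℂ] E) {A : E →L[ℂ] E} (hA : A ∈ finiteRankOperators E) :
    S ∘L A ∈ finiteRankOperators E := by
  change FiniteDimensional ℂ (LinearMap.range ((S ∘L A : E →L[ℂ] E) : E →ₗ[ℂ] E))
  have h : FiniteDimensional ℂ (LinearMap.range (A : E →ₗ[ℂ] E)) := hA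
  rw [ContinuousLinearMap.toLinearMap_comp, LinearMap.range_comp]
  infer_instance

theorem finiteRank_comp (S : E →L[ℂ] E) {A : E →L[ℂ] E} (hA : A ∈ finiteRankOperators E) :
    A ∘L S ∈ finiteRankOperators E := by
  change FiniteDimensional ℂ (LinearMap.range ((A ∘L S : E →L[ℂ] E) : E →ₗ[ℂ] E))
  have h : FiniteDimensional ℂ (LinearMap.range (A : E →ₗ[ℂ] E)) := hA
  rw [ContinuousLinearMap.toLinearMap_comp]
  exact Submodule.finiteDimensional_of_le (LinearMap.range_comp_le_range _ _)

theorem comp_approximable (S : E →L[ℂ] E) {A : E →L[ℂ] E} (hA : A ∈ approximableOperators E) :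
    S ∘L A ∈ approximableOperators E :=
  map_mem_closure (f := fun A : E →L[ℂ] E => S ∘L A)
    (by fun_prop) hA (fun _ h => comp_finiteRank S h)

theorem approximable_comp (S : E →L[ℂ] E) {A : E →L[ℂ] E} (hA : A ∈ approximableOperators E) :
    A ∘L S ∈ approximableOperators E :=
  map_mem_closure (f := fun A : E →L[ℂ] E => A ∘L S)
    (by fun_prop) hA (fun _ h => finiteRank_comp S h)

variable (E)

/-- The space `𝒜(E)` of approximable operators as a type, with the operator norm. -/
def ApproximableOp : Type _ := approximableOperators E

namespace ApproximableOp

instance : NormedAddCommGroup (ApproximableOp E) :=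
  Submodule.normedAddCommGroup (approximableOperators E)

instance : NormedSpace ℂ (ApproximableOp E) :=
  Submodule.normedSpace (approximableOperators E)

variable {E}

/-- The inclusion of `𝒜(E)` in `ℬ(E)`. -/
def toCLM : ApproximableOp E →ₗᵢ[ℂ] (E →L[ℂ] E) where
  toFun A := A.1
  map_add' _ _ := rfl
  map_smul' _ _ := rfl
  norm_map' _ := rfl

/-- An approximable operator as an element of `𝒜(E)`. -/
def mk (A : E →L[ℂ] E) (hA : A ∈ approximableOperators E) : ApproximableOp E := ⟨A, hA⟩

theorem toCLM_mem (A : ApproximableOp E) : toCLM A ∈ approximableOperators E := A.2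

@[simp] theorem toCLM_mk (A : E →L[ℂ] E) (hA : A ∈ approximableOperators E) :
    toCLM (mk A hA) = A := rfl

@[ext] theorem ext {A B : ApproximableOp E} (h : toCLM A = toCLM B) : A = B :=
  toCLM.injective h

end ApproximableOp

open ApproximableOp

/-- The action of `ℬ(E)` on its ideal `𝒜(E)` from the left: `(S, A) ↦ S ∘ A`. -/
def leftMul : (E →L[ℂ] E) →L[ℂ] ApproximableOp E →L[ℂ] ApproximableOp E :=
  LinearMap.mkContinuous₂
    (LinearMap.mk₂ ℂ
      (fun (S : E →L[ℂ] E) (A : ApproximableOp E) =>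
        mk (S ∘L A.toCLM) (comp_approximable S A.toCLM_mem))
      (fun _ _ _ => by ext; simp) (fun _ _ _ => by ext; simp)
      (fun _ _ _ => by ext; simp) (fun _ _ _ => by ext; simp))
    1 (fun S A => by
      rw [one_mul]
      exact ContinuousLinearMap.opNorm_comp_le S A.toCLM)

/-- The action of `ℬ(E)` on its ideal `𝒜(E)` from the right: `(S, A) ↦ A ∘ S`. -/
def rightMul : (E →L[ℂ] E) →L[ℂ] ApproximableOp E →L[ℂ] ApproximableOp E :=
  LinearMap.mkContinuous₂
    (LinearMap.mk₂ ℂ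
      (fun (S : E →L[ℂ] E) (A : ApproximableOp E) =>
        mk (A.toCLM ∘L S) (approximable_comp S A.toCLM_mem))
      (fun _ _ _ => by ext; simp) (fun _ _ _ => by ext; simp)
      (fun _ _ _ => by ext; simp) (fun _ _ _ => by ext; simp))
    1 (fun S A => by
      rw [one_mul, mul_comm]
      exact ContinuousLinearMap.opNorm_comp_le A.toCLM S)

@[simp] theorem toCLM_leftMul (S : E →L[ℂ] E) (A : ApproximableOp E) :
    (leftMul E S A).toCLM = S ∘L A.toCLM := rfl

@[simp] theorem toCLM_rightMul (S : E →L[ℂ] E) (A : ApproximableOp E) :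
    (rightMul E S A).toCLM = A.toCLM ∘L S := rfl

variable {E}

/-- The left action of `ℬ(E)` on the dual bimodule `𝒜(E)*`: `⟨A, S · φ⟩ = ⟨A ∘ S, φ⟩`. -/
def dualLeft (S : E →L[ℂ] E) (φ : StrongDual ℂ (ApproximableOp E)) :
    StrongDual ℂ (ApproximableOp E) :=
  φ ∘L rightMul E S

/-- The right action of `ℬ(E)` on the dual bimodule `𝒜(E)*`: `⟨A, φ · S⟩ = ⟨S ∘ A, φ⟩`. -/
def dualRight (φ : StrongDual ℂ (ApproximableOp E)) (S : E →L[ℂ] E) :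
    StrongDual ℂ (ApproximableOp E) :=
  φ ∘L leftMul E S

variable (E)

/-- The bounded derivations `ℬ(E) → 𝒜(E)*` (the bounded Hochschild 1-cocycles): the bounded
linear maps `D` with `D (S T) = S · D T + D S · T`. -/
def boundedDerivations :
    Submodule ℂ ((E →L[ℂ] E) →L[ℂ] StrongDual ℂ (ApproximableOp E)) where
  carrier := {D | ∀ S T : E →L[ℂ] E, D (S ∘L T) = dualLeft S (D T) + dualRight (D S) T}
  zero_mem' := by
    intro S T
    simp [dualLeft, dualRight]
  add_mem' := by
    intro D D' h h' S T
    simp only [add_apply, h S T, h' S T, dualLeft, dualRight,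
      ContinuousLinearMap.add_comp]
    abel
  smul_mem' := by
    intro c D h S T
    simp only [smul_apply, h S T, dualLeft, dualRight,
      ContinuousLinearMap.smul_comp, smul_add]

/-- The map taking `φ ∈ 𝒜(E)*` to the inner derivation `S ↦ S · φ - φ · S` (the Hochschild
coboundary map from degree 0 to degree 1). -/
def innerDerivation : StrongDual ℂ (ApproximableOp E) →ₗ[ℂ]
    ((E →L[ℂ] E) →L[ℂ] StrongDual ℂ (ApproximableOp E)) where
  toFun φ := ContinuousLinearMap.compL ℂ _ _ ℂ φ ∘L (rightMul E - leftMul E)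
  map_add' _ _ := by ext; simp; abel
  map_smul' _ _ := by ext; simp [mul_sub]

theorem innerDerivation_apply (φ : StrongDual ℂ (ApproximableOp E)) (S : E →L[ℂ] E) :
    innerDerivation E φ S = dualLeft S φ - dualRight φ S := by
  ext A
  simp [innerDerivation, dualLeft, dualRight]

/-- The inner derivations `ℬ(E) → 𝒜(E)*` (the Hochschild 1-coboundaries). -/
def innerDerivations :
    Submodule ℂ ((E →L[ℂ] E) →L[ℂ] StrongDual ℂ (ApproximableOp E)) :=
  LinearMap.range (innerDerivation E)

theorem innerDerivations_le : innerDerivations E ≤ boundedDerivations E := by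
  rintro _ ⟨φ, rfl⟩ S T
  ext A
  have h₁ : rightMul E (S ∘L T) A = rightMul E T (rightMul E S A) := rfl
  have h₂ : leftMul E (S ∘L T) A = leftMul E S (leftMul E T A) := rfl
  have h₃ : leftMul E T (rightMul E S A) = rightMul E S (leftMul E T A) := rfl
  simp [innerDerivation_apply, dualLeft, dualRight, h₁, h₂, h₃]

instance instAddCommGroupBoundedDerivations : AddCommGroup (boundedDerivations E) :=
  Submodule.addCommGroup (R := ℂ) (M := (E →L[ℂ] E) →L[ℂ] StrongDual ℂ (ApproximableOp E)) _

/-- The first bounded Hochschild cohomology group `ℋ¹(ℬ(E), 𝒜(E)*)`: bounded derivations modulo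
inner derivations. -/
abbrev H1 : Type _ :=
  boundedDerivations E ⧸ (innerDerivations E).submoduleOf (boundedDerivations E)

end BanachCohomology

end

open scoped ENNReal
open Filter Topology

noncomputable section

namespace BanachCohomology

/-! ### The isometry of `ℓ_p(X)` with the `ℓ_p`-sum of countably many copies of itself. -/

section Blocks

variable {X : Type*} [NormedAddCommGroup X] {p : ℝ≥0∞} [Fact (1 ≤ p)]

/-! Write `E = ℓ_p(X)`. Since `E` is isometric to `ℓ_p(E)`, there are block inclusions `Uᵢ` and
projections `Vᵢ` with `Vᵢ Uᵢ = 1`, and each `S` has an amplification `T = diag(S, S, …)` with `Vᵢ T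
= S Vᵢ` and `T Uᵢ = Uᵢ S`. Put `ψᵢ = Vᵢ · D(Uᵢ)`. The derivation rule on `S = Vᵢ T Uᵢ` shows that
`D(S)` and the inner derivation of `ψᵢ` differ at `A` by `D(T)(Uᵢ A Vᵢ)` (`derivation_compression`).

Averaging over `i < n` turns this error into `D(T)(∑ Uᵢ A Vᵢ) / n`. The sum is block diagonal, so
its norm is at most `‖A‖` for every `n` (`norm_sum_blockIncl_comp_le`), and the error is `O(1/n)`.
The averages of the `ψᵢ` are bounded by `‖D‖`, and a weak-* limit point `φ` of them implements `D`.
-/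

theorem toReal_pos_of_one_le (hp : p ≠ ∞) : 0 < p.toReal :=
  ENNReal.toReal_pos (zero_lt_one.trans_le Fact.out).ne' hp

theorem hasSum_pair_norm_rpow (hp : p ≠ ∞) (x : lp (fun _ : ℕ => X) p) :
    HasSum (fun k : ℕ × ℕ => ‖x (Nat.pair k.1 k.2)‖ ^ p.toReal) (‖x‖ ^ p.toReal) :=
  (Nat.pairEquiv.hasSum_iff (f := fun m => ‖x m‖ ^ p.toReal)).2
    (lp.hasSum_norm (toReal_pos_of_one_le hp) x)

/-- The `i`-th block of a sequence, with respect to the pairing `ℕ × ℕ ≃ ℕ`. -/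
def block (hp : p ≠ ∞) (i : ℕ) (x : lp (fun _ : ℕ => X) p) : lp (fun _ : ℕ => X) p :=
  ⟨fun n => x (Nat.pair i n), memℓp_gen ((hasSum_pair_norm_rpow hp x).summable.prod_factor i)⟩

@[simp] theorem block_apply (hp : p ≠ ∞) (i : ℕ) (x : lp (fun _ : ℕ => X) p) (n : ℕ) :
    block hp i x n = x (Nat.pair i n) := rfl

/-- This is the isometry of `E` with `ℓ_p(E)`; the norm bounds for all block operators come from it.
-/
theorem hasSum_norm_block (hp : p ≠ ∞) (x : lp (fun _ : ℕ => X) p) :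
    HasSum (fun i => ‖block hp i x‖ ^ p.toReal) (‖x‖ ^ p.toReal) :=
  (hasSum_pair_norm_rpow hp x).prod_fiberwise
    fun i => lp.hasSum_norm (toReal_pos_of_one_le hp) (block hp i x)

theorem norm_block_le (hp : p ≠ ∞) (i : ℕ) (x : lp (fun _ : ℕ => X) p) :
    ‖block hp i x‖ ≤ ‖x‖ := by
  have h := le_hasSum (hasSum_norm_block hp x) i fun _ _ => by positivity
  exact (Real.rpow_le_rpow_iff (norm_nonneg _) (norm_nonneg _) (toReal_pos_of_one_le hp)).1 h

theorem memℓp_glue (hp : p ≠ ∞) (f : ℕ → lp (fun _ : ℕ => X) p)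
    (hf : Summable fun i => ‖f i‖ ^ p.toReal) :
    Memℓp (E := fun _ : ℕ => X) (fun m => f m.unpair.1 m.unpair.2) p := by
  have hs := fun i => lp.hasSum_norm (toReal_pos_of_one_le hp) (f i)
  have h : Summable fun k : ℕ × ℕ => ‖f k.1 k.2‖ ^ p.toReal := by
    refine (summable_prod_of_nonneg fun _ => Real.rpow_nonneg (norm_nonneg _) _).2
      ⟨fun i => (hs i).summable, ?_⟩
    simpa only [(hs _).tsum_eq] using hf
  have h' := Nat.pairEquiv.symm.summable_iff.2 h
  simp only [Function.comp_def, Nat.pairEquiv_symm_apply] at h'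
  exact memℓp_gen h'

/-- The sequence with prescribed blocks. -/
def glue (hp : p ≠ ∞) (f : ℕ → lp (fun _ : ℕ => X) p)
    (hf : Summable fun i => ‖f i‖ ^ p.toReal) : lp (fun _ : ℕ => X) p :=
  ⟨fun m => f m.unpair.1 m.unpair.2, memℓp_glue hp f hf⟩

@[simp] theorem block_glue (hp : p ≠ ∞) (f : ℕ → lp (fun _ : ℕ => X) p)
    (hf : Summable fun i => ‖f i‖ ^ p.toReal) (i : ℕ) : block hp i (glue hp f hf) = f i := by
  ext n
  simp [glue]

theorem ext_block (hp : p ≠ ∞) {x y : lp (fun _ : ℕ => X) p}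
    (h : ∀ i, block hp i x = block hp i y) : x = y := by
  ext m
  simpa using congrArg (fun z : lp (fun _ : ℕ => X) p => z m.unpair.2) (h m.unpair.1)

theorem summable_single (hp : p ≠ ∞) (i : ℕ) (x : lp (fun _ : ℕ => X) p) :
    Summable fun j => ‖(Pi.single i x : ℕ → lp (fun _ : ℕ => X) p) j‖ ^ p.toReal :=
  summable_of_ne_finset_zero (s := {i}) fun j hj => by
    rw [Pi.single_eq_of_ne (by simpa using hj), norm_zero,
      Real.zero_rpow (toReal_pos_of_one_le hp).ne']

variable [NormedSpace ℂ X]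

/-- The operator extracting the `i`-th block. -/
def blockProj (hp : p ≠ ∞) (i : ℕ) : lp (fun _ : ℕ => X) p →L[ℂ] lp (fun _ : ℕ => X) p :=
  LinearMap.mkContinuous
    { toFun := block hp i
      map_add' := fun _ _ => rfl
      map_smul' := fun _ _ => rfl } 1 fun x => (norm_block_le hp i x).trans_eq (one_mul _).symm

theorem blockProj_apply (hp : p ≠ ∞) (i : ℕ) (x : lp (fun _ : ℕ => X) p) :
    blockProj hp i x = block hp i x := rfl

theorem norm_blockProj_le (hp : p ≠ ∞) (i : ℕ) :
    ‖(blockProj hp i : lp (fun _ : ℕ => X) p →L[ℂ] lp (fun _ : ℕ => X) p)‖ ≤ 1 :=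
  LinearMap.mkContinuous_norm_le _ zero_le_one _

theorem ext_blockProj (hp : p ≠ ∞) {S T : lp (fun _ : ℕ => X) p →L[ℂ] lp (fun _ : ℕ => X) p}
    (h : ∀ i, blockProj hp i ∘L S = blockProj hp i ∘L T) : S = T :=
  ContinuousLinearMap.ext fun x => ext_block hp fun i => DFunLike.congr_fun (h i) x

/-- The operator placing a sequence into the `i`-th block. -/
def blockIncl (hp : p ≠ ∞) (i : ℕ) : lp (fun _ : ℕ => X) p →L[ℂ] lp (fun _ : ℕ => X) p :=
  LinearMap.mkContinuous
    { toFun := fun x => glue hp (Pi.single i x) (summable_single hp i x)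
      map_add' := fun x y => ext_block hp fun j => by
        rw [← blockProj_apply hp j (_ + _), map_add]
        simp [blockProj_apply, Pi.single_add]
      map_smul' := fun c x => ext_block hp fun j => by
        rw [← blockProj_apply hp j (_ • _), map_smul]
        simp [blockProj_apply, Pi.single_smul] } 1 fun x => by
    have hq := toReal_pos_of_one_le hp
    rw [one_mul, ← Real.rpow_le_rpow_iff (norm_nonneg _) (norm_nonneg _) hq]
    refine (hasSum_norm_block hp _).unique ?_ |>.le
    convert hasSum_single i fun j hj => ?_ using 1
    · simp
    · simp [Pi.single_eq_of_ne hj, Real.zero_rpow hq.ne']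

theorem norm_blockIncl_le (hp : p ≠ ∞) (i : ℕ) :
    ‖(blockIncl hp i : lp (fun _ : ℕ => X) p →L[ℂ] lp (fun _ : ℕ => X) p)‖ ≤ 1 :=
  LinearMap.mkContinuous_norm_le _ zero_le_one _

theorem block_blockIncl (hp : p ≠ ∞) (i j : ℕ) (x : lp (fun _ : ℕ => X) p) :
    block hp j (blockIncl hp i x) = (Pi.single i x : ℕ → lp (fun _ : ℕ => X) p) j :=
  block_glue hp _ (summable_single hp i x) j

theorem blockProj_comp_blockIncl (hp : p ≠ ∞) (i : ℕ) :
    blockProj hp i ∘L blockIncl hp i = ContinuousLinearMap.id ℂ (lp (fun _ : ℕ => X) p) :=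
  ContinuousLinearMap.ext fun x => by simp [blockProj_apply, block_blockIncl]

variable (hp : p ≠ ∞) {T : ℕ → lp (fun _ : ℕ => X) p →L[ℂ] lp (fun _ : ℕ => X) p} {C : ℝ}

theorem norm_block_rpow_le (hT : ∀ i, ‖T i‖ ≤ C) (x : lp (fun _ : ℕ => X) p) (i : ℕ) :
    ‖T i (block hp i x)‖ ^ p.toReal ≤ C ^ p.toReal * ‖block hp i x‖ ^ p.toReal := by
  rw [← Real.mul_rpow ((norm_nonneg _).trans (hT i)) (norm_nonneg _)]
  exact Real.rpow_le_rpow (norm_nonneg _) ((T i).le_of_opNorm_le (hT i) _) ENNReal.toReal_nonneg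

theorem summable_blockDiag (hT : ∀ i, ‖T i‖ ≤ C) (x : lp (fun _ : ℕ => X) p) :
    Summable fun i => ‖T i (block hp i x)‖ ^ p.toReal :=
  .of_nonneg_of_le (fun _ => by positivity) (norm_block_rpow_le hp hT x)
    ((hasSum_norm_block hp x).summable.mul_left _)

/-- The block diagonal operator with entries from a bounded sequence of operators. -/
def blockDiag (hT : ∀ i, ‖T i‖ ≤ C) : lp (fun _ : ℕ => X) p →L[ℂ] lp (fun _ : ℕ => X) p :=
  LinearMap.mkContinuous
    { toFun := fun x => glue hp (fun i => T i (block hp i x)) (summable_blockDiag hp hT x)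
      map_add' := fun x y => ext_block hp fun j => by
        rw [← blockProj_apply hp j (_ + _), map_add]
        simp only [blockProj_apply, block_glue]
        simp only [← blockProj_apply, map_add]
      map_smul' := fun c x => ext_block hp fun j => by
        rw [← blockProj_apply hp j (_ • _), map_smul]
        simp only [blockProj_apply, block_glue]
        simp only [← blockProj_apply, map_smul, RingHom.id_apply] } C fun x => by
    have hC : 0 ≤ C := (norm_nonneg _).trans (hT 0)
    rw [← Real.rpow_le_rpow_iff (norm_nonneg _) (by positivity) (toReal_pos_of_one_le hp),
      Real.mul_rpow hC (norm_nonneg _)]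
    refine hasSum_le (fun i => ?_) (hasSum_norm_block hp _)
      ((hasSum_norm_block hp x).mul_left (C ^ p.toReal))
    simpa using norm_block_rpow_le hp hT x i

theorem norm_blockDiag_le (hT : ∀ i, ‖T i‖ ≤ C) : ‖blockDiag hp hT‖ ≤ C :=
  LinearMap.mkContinuous_norm_le _ ((norm_nonneg _).trans (hT 0)) _

theorem block_blockDiag (hT : ∀ i, ‖T i‖ ≤ C) (i : ℕ) (x : lp (fun _ : ℕ => X) p) :
    block hp i (blockDiag hp hT x) = T i (block hp i x) :=
  block_glue hp _ (summable_blockDiag hp hT x) i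

theorem blockProj_comp_blockDiag (hT : ∀ i, ‖T i‖ ≤ C) (i : ℕ) :
    blockProj hp i ∘L blockDiag hp hT = T i ∘L blockProj hp i :=
  ContinuousLinearMap.ext fun x => block_blockDiag hp hT i x

theorem blockDiag_comp_blockIncl (hT : ∀ i, ‖T i‖ ≤ C) (i : ℕ) :
    blockDiag hp hT ∘L blockIncl hp i = blockIncl hp i ∘L T i := by
  refine ContinuousLinearMap.ext fun x => ext_block hp fun j => ?_
  simp only [ContinuousLinearMap.comp_apply, block_blockDiag, block_blockIncl]
  obtain rfl | h := eq_or_ne j i <;> simp [*]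

/-- The bound does not grow with `n`, because the summands act on disjoint blocks. This is what
makes the averaged error vanish. -/
theorem norm_sum_blockIncl_comp_le (A : lp (fun _ : ℕ => X) p →L[ℂ] lp (fun _ : ℕ => X) p)
    (n : ℕ) :
    ‖∑ i ∈ Finset.range n, blockIncl hp i ∘L A ∘L blockProj hp i‖ ≤ ‖A‖ := by
  -- The sum is the diagonal operator with entry `A` in the first `n` blocks and `0` afterwards.
  have hT : ∀ i, ‖if i < n then A else 0‖ ≤ ‖A‖ := fun i => by split_ifs <;> simp
  convert norm_blockDiag_le hp hT
  refine ext_blockProj hp fun j => ContinuousLinearMap.ext fun x => ?_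
  rw [blockProj_comp_blockDiag]
  simp only [ContinuousLinearMap.comp_apply, sum_apply, map_sum]
  simp only [blockProj_apply, block_blockIncl, Pi.single_apply]
  split_ifs with h <;> simp [h]

end Blocks

/-! ### Derivations, averaging and the weak-* limit. -/

section Derivations

variable {E : Type*} [NormedAddCommGroup E] [NormedSpace ℂ E]

theorem norm_rightMul_apply_le (S : E →L[ℂ] E) : ‖rightMul E S‖ ≤ ‖S‖ :=
  (ContinuousLinearMap.le_of_opNorm_le _
    (LinearMap.mkContinuous₂_norm_le _ zero_le_one _) S).trans_eq (one_mul _)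

theorem norm_dualLeft_le (S : E →L[ℂ] E) (φ : StrongDual ℂ (ApproximableOp E)) :
    ‖dualLeft S φ‖ ≤ ‖φ‖ * ‖S‖ :=
  (ContinuousLinearMap.opNorm_comp_le _ _).trans <|
    mul_le_mul_of_nonneg_left (norm_rightMul_apply_le S) (norm_nonneg _)

theorem derivation_id {D : (E →L[ℂ] E) →L[ℂ] StrongDual ℂ (ApproximableOp E)}
    (hD : D ∈ boundedDerivations E) : D (ContinuousLinearMap.id ℂ E) = 0 := by
  have h := hD (.id ℂ E) (.id ℂ E)
  have h₁ : ∀ φ, dualLeft (.id ℂ E) φ = φ := fun _ => rfl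
  have h₂ : ∀ φ, dualRight φ (.id ℂ E) = φ := fun _ => rfl
  rw [ContinuousLinearMap.id_comp, h₁, h₂] at h
  exact left_eq_add.1 h

/-- Compressing a derivation to a complemented copy of the space changes it by an inner one. -/
theorem derivation_compression {D : (E →L[ℂ] E) →L[ℂ] StrongDual ℂ (ApproximableOp E)}
    (hD : D ∈ boundedDerivations E) {S T U V : E →L[ℂ] E}
    (hVU : V ∘L U = .id ℂ E) (hV : V ∘L T = S ∘L V) (hU : T ∘L U = U ∘L S)
    (A : ApproximableOp E) :
    D T (leftMul E U (rightMul E V A)) =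
      D S A - (dualLeft V (D U) (rightMul E S A) - dualLeft V (D U) (leftMul E S A)) := by
  have hS : S = V ∘L (T ∘L U) := by
    rw [hU, ← ContinuousLinearMap.comp_assoc, hVU, ContinuousLinearMap.id_comp]
  -- Applying `D` to `V U = 1` gives `D(V) · U = -V · D(U)`, which eliminates `D(V)` below.
  have h₀ : dualLeft V (D U) + dualRight (D V) U = 0 := by
    rw [← hD, hVU, derivation_id hD]
  have h₁ : D S A = D U (rightMul E T (rightMul E V A)) + D T (leftMul E U (rightMul E V A))
      + D V (leftMul E (T ∘L U) A) := by
    conv_lhs => rw [hS, hD, hD]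
    rfl
  have h₂ : rightMul E T (rightMul E V A) = rightMul E V (rightMul E S A) := by
    ext1
    simp only [toCLM_rightMul, ContinuousLinearMap.comp_assoc, hV]
  have h₃ : leftMul E (T ∘L U) A = leftMul E U (leftMul E S A) := by
    rw [hU]; rfl
  have h₄ : D U (rightMul E V (leftMul E S A)) + D V (leftMul E U (leftMul E S A)) = 0 :=
    DFunLike.congr_fun h₀ (leftMul E S A)
  rw [h₁, h₂, h₃]
  change _ = _ - (D U (rightMul E V (rightMul E S A)) - D U (rightMul E V (leftMul E S A)))
  linear_combination -h₄

/-- A norm bounded sequence of functionals has a pointwise limit along an ultrafilter. -/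
theorem exists_tendsto_of_norm_le {F : Type*} [NormedAddCommGroup F] [NormedSpace ℂ F]
    (ψ : ℕ → StrongDual ℂ F) {C : ℝ} (hψ : ∀ n, ‖ψ n‖ ≤ C) (l : Ultrafilter ℕ) :
    ∃ φ : StrongDual ℂ F, ∀ x, Tendsto (fun n => ψ n x) l (𝓝 (φ x)) := by
  obtain ⟨φ, -, h⟩ := (WeakDual.isCompact_closedBall (𝕜 := ℂ) (E := F) 0 C).ultrafilter_le_nhds
    (l.map fun n => StrongDual.toWeakDual (ψ n)) (by
      refine le_principal_iff.2 (Filter.mem_map.2 (Filter.univ_mem' fun n => ?_))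
      simpa using hψ n)
  exact ⟨WeakDual.toStrongDual φ, fun x => ((WeakDual.eval_continuous x).tendsto φ).comp h⟩

theorem derivation_lp_inner {X : Type*} [NormedAddCommGroup X] [NormedSpace ℂ X]
    {p : ℝ≥0∞} [Fact (1 ≤ p)] (hp : p ≠ ∞)
    {D : (lp (fun _ : ℕ => X) p →L[ℂ] lp (fun _ : ℕ => X) p) →L[ℂ]
      StrongDual ℂ (ApproximableOp (lp (fun _ : ℕ => X) p))}
    (hD : D ∈ boundedDerivations (lp (fun _ : ℕ => X) p)) :
    ∃ φ : StrongDual ℂ (ApproximableOp (lp (fun _ : ℕ => X) p)),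
      ∀ S : lp (fun _ : ℕ => X) p →L[ℂ] lp (fun _ : ℕ => X) p,
        D S = dualLeft S φ - dualRight φ S := by
  set E := lp (fun _ : ℕ => X) p
  let ψ : ℕ → StrongDual ℂ (ApproximableOp E) := fun i =>
    dualLeft (blockProj hp i) (D (blockIncl hp i))
  have hψ : ∀ i, ‖ψ i‖ ≤ ‖D‖ := fun i =>
    calc ‖ψ i‖ ≤ ‖D (blockIncl hp i)‖ * ‖(blockProj hp i : E →L[ℂ] E)‖ := norm_dualLeft_le _ _
      _ ≤ (‖D‖ * 1) * 1 := by
        gcongr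
        · exact D.le_of_opNorm_le_of_le le_rfl (norm_blockIncl_le hp i)
        · exact norm_blockProj_le hp i
      _ = ‖D‖ := by ring
  -- Averages of `n + 1` terms, so that the divisor is never zero.
  let avg : ℕ → StrongDual ℂ (ApproximableOp E) := fun n =>
    ((n : ℂ) + 1)⁻¹ • ∑ i ∈ Finset.range (n + 1), ψ i
  have hn (n : ℕ) : ‖((n : ℂ) + 1)⁻¹‖ = ((n : ℝ) + 1)⁻¹ := by
    rw [norm_inv]
    exact_mod_cast congrArg (·⁻¹) (Complex.norm_natCast (n + 1))
  have havg : ∀ n, ‖avg n‖ ≤ ‖D‖ := fun n => by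
    have h := norm_sum_le_of_le (Finset.range (n + 1)) fun i _ => hψ i
    rw [Finset.sum_const, Finset.card_range, nsmul_eq_mul] at h
    rw [norm_smul, hn, inv_mul_le_iff₀ (by positivity)]
    exact_mod_cast h
  -- The predual `𝒜(E)` need not be separable, so the weak-* limit is taken along a free ultrafilter
  -- instead of a subsequence.
  obtain ⟨φ, hφ⟩ := exists_tendsto_of_norm_le avg havg (hyperfilter ℕ)
  refine ⟨φ, fun S => ContinuousLinearMap.ext fun A => ?_⟩
  -- The constant sequence `S`: `blockDiag hp hT` is the amplification of `S`, and it does not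
  -- depend on the block index.
  have hT (_ : ℕ) : ‖S‖ ≤ ‖S‖ := le_rfl
  have key : ∀ n : ℕ, ‖D S A - (avg n (rightMul E S A) - avg n (leftMul E S A))‖ ≤
      ‖D (blockDiag hp hT)‖ * ‖A‖ * ((n : ℝ) + 1)⁻¹ := fun n => by
    have h0 : (n : ℂ) + 1 ≠ 0 := Nat.cast_add_one_ne_zero n
    have h1 : D S A - (avg n (rightMul E S A) - avg n (leftMul E S A)) =
        ((n : ℂ) + 1)⁻¹ * D (blockDiag hp hT)
          (∑ i ∈ Finset.range (n + 1), leftMul E (blockIncl hp i) (rightMul E (blockProj hp i) A)) := by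
      rw [map_sum, Finset.sum_congr rfl fun i _ => derivation_compression hD
        (blockProj_comp_blockIncl hp i) (blockProj_comp_blockDiag hp hT i)
        (blockDiag_comp_blockIncl hp hT i) A]
      simp only [avg, ψ, smul_apply, sum_apply,
        Finset.sum_sub_distrib, Finset.sum_const, Finset.card_range, nsmul_eq_mul, smul_eq_mul]
      push_cast
      field_simp
      rfl
    have h2 : ‖∑ i ∈ Finset.range (n + 1),
        leftMul E (blockIncl hp i) (rightMul E (blockProj hp i) A)‖ ≤ ‖A‖ := by
      rw [← ApproximableOp.toCLM.norm_map, ← ApproximableOp.toCLM.norm_map A, map_sum]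
      exact norm_sum_blockIncl_comp_le hp A.toCLM (n + 1)
    rw [h1, norm_mul, hn, mul_comm]
    gcongr
    exact ContinuousLinearMap.le_of_opNorm_le_of_le _ le_rfl h2
  have hlim : Tendsto (fun n => D S A - (avg n (rightMul E S A) - avg n (leftMul E S A)))
      (hyperfilter ℕ) (𝓝 (D S A - (φ (rightMul E S A) - φ (leftMul E S A)))) :=
    tendsto_const_nhds.sub ((hφ _).sub (hφ _))
  have hzero : Tendsto (fun n => D S A - (avg n (rightMul E S A) - avg n (leftMul E S A)))
      (hyperfilter ℕ) (𝓝 0) := by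
    refine squeeze_zero_norm key ?_
    have h := (tendsto_one_div_add_atTop_nhds_zero_nat (𝕜 := ℝ)).const_mul
      (‖D (blockDiag hp hT)‖ * ‖A‖)
    simp only [one_div, mul_zero] at h
    -- The ultrafilter is free, so ordinary convergence to zero passes to it.
    exact h.mono_left Nat.hyperfilter_le_atTop
  exact sub_eq_zero.1 (tendsto_nhds_unique hlim hzero)

end Derivations

end BanachCohomology

end

open BanachCohomology in
theorem theorem4p1 {X : Type*} [NormedAddCommGroup X] [NormedSpace ℂ X] [CompleteSpace X]
    (p : ℝ≥0∞) [Fact (1 ≤ p)] (hp : p ≠ ∞) :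
    Subsingleton (H1 (lp (fun _ : ℕ => X) p)) ∧
    ∀ D ∈ boundedDerivations (lp (fun _ : ℕ => X) p),
      ∃ φ : StrongDual ℂ (ApproximableOp (lp (fun _ : ℕ => X) p)),
        ∀ S : lp (fun _ : ℕ => X) p →L[ℂ] lp (fun _ : ℕ => X) p,
          D S = dualLeft S φ - dualRight φ S := by
  have inner := fun D hD => derivation_lp_inner (X := X) hp (D := D) hD
  refine ⟨?_, inner⟩
  rw [H1, Submodule.Quotient.subsingleton_iff, Submodule.submoduleOf, Submodule.comap_subtype_eq_top]
  intro D hD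
  obtain ⟨φ, hφ⟩ := inner D hD
  exact ⟨φ, ContinuousLinearMap.ext fun S => (innerDerivation_apply _ φ S).trans (hφ S).symm⟩
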